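/- Let $(\mathsf X_1,\mathsf X_2)$ have joint pmf $p$ on $\mathcal X_1\times\mathcal X_2$ with finite alphabets, and for a block length $n$ let $(X_1^n,X_2^n)$ consist of $n$ i.i.d. copies of $(\mathsf X_1,\mathsf X_2)$; $X_1^n$ and $X_2^n$ are the two library files. All entropies are in bits. Fix a cache capacity $M\ge 0$. A caching scheme of block length $n$ for two receivers consists of - cache encoders $f_i:\mathcal X_1^n\times\mathcal X_2^n\to\{1,\dots,\lfloor 2^{nM}\rfloor\}$, $i=1,2$, which give the cache contents $Z_i=f_i(X_1^n,X_2^n)$; - a multicast encoder which maps each demand $\mathbf d=(d_1,d_2)\in\{1,2\}^2$ together with $(Z_1,Z_2)$ and $(X_1^n,X_2^n)$ to a finite binary string $Y_{\mathbf d}$ of variable length $L(Y_{\mathbf d})$; - decoders $g_i$, $i=1,2$, which give $\widehat X_{i,\mathbf d}=g_i(\mathbf d,Y_{\mathbf d},Z_i)\in\mathcal X_{d_i}^n$. Its error probability is $P_e=\max_{\mathbf d}\max_{i}\Pr(\widehat X_{i,\mathbf d}\ne X_{d_i}^n)$ and its peak rate is $\max_{\mathbf d}\mathbb E[L(Y_{\mathbf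 d})]/n$. A pair $(R,M)$ is achievable if there is a sequence of schemes for cache capacity $M$, with strictly increasing block lengths, whose error probabilities tend to $0$ and whose peak rates have $\limsup$ at most $R$. Let $\mathcal R$ be the closure in $\mathbb R^2$ of the set of achievable pairs, and let $R^*(M)=\inf\{R:(R,M)\in\mathcal R\}$. Theorem. For every $M\ge 0$, the set $\{R:(R,M)\in\mathcal R\}$ is nonempty and bounded below (so that $R^*(M)$ is a real number), and $R^*(M)\ge R^{LB}(M)$, where $$R^{LB}(M)=\inf\Big\{R:\ R\ge H(\mathsf X_1,\mathsf X_2)-2M,\quad R\ge\tfrac12\big(H(\mathsf X_1,\mathsf X_2)-M\big),\quad R\ge\tfrac12\big(H(\mathsf X_1,\mathsf X_2)+\max\{H(\mathsf X_1),H(\mathsf X_2)\}\big)-M\Big\}.$$ -/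

import Mathlib

open Filter Topology

namespace CodedCaching

noncomputable section

/-- Shannon entropy, in bits, of a probability mass function on a finite alphabet. -/
def entropy {α : Type*} [Fintype α] (q : PMF α) : ℝ :=
  ∑ a, Real.negMulLog (q a).toReal / Real.log 2

/-- A realization `(x₁ⁿ, x₂ⁿ)` of the two library files; file `j` has alphabet `𝒳 j`. -/
abbrev Library (𝒳 : Fin 2 → Type*) (n : ℕ) : Type _ := (j : Fin 2) → Fin n → 𝒳 j

/-- A demand: receiver `i` requests file `d i`. -/
abbrev Demand : Type := Fin 2 → Fin 2

/-- Possible contents of one cache of `n * M` bits: the index set has `⌊2 ^ (n M)⌋` elements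
(so it is empty when `M < 0 < n`). -/
abbrev CacheContent (n : ℕ) (M : ℝ) : Type := Fin ⌊(2 : ℝ) ^ ((n : ℝ) * M)⌋₊

/-- A cache-aided coded multicast scheme of block length `n` and cache capacity `M`.
Codewords are finite binary strings of variable length. -/
structure Scheme (𝒳 : Fin 2 → Type*) (n : ℕ) (M : ℝ) where
  /-- the cache encoder of each receiver -/
  cache : Fin 2 → Library 𝒳 n → CacheContent n M
  /-- the multicast encoder, which sees the demand, both caches and both files -/
  encode : Demand → (Fin 2 → CacheContent n M) → Library 𝒳 n → List Bool
  /-- the decoder of each receiver, which sees the demand, the codeword and its own cache -/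
  decode : (i : Fin 2) → (d : Demand) → List Bool → CacheContent n M → (Fin n → 𝒳 (d i))

/-- Probability of a library realization: the pairs `(X₁ₜ, X₂ₜ)`, `t = 1, …, n`, are i.i.d. with
joint pmf `p`. -/
def libraryProb {𝒳 : Fin 2 → Type*} (p : PMF ((j : Fin 2) → 𝒳 j)) {n : ℕ}
    (x : Library 𝒳 n) : ℝ :=
  ∏ t, (p fun j => x j t).toReal

namespace Scheme

variable {𝒳 : Fin 2 → Type*} {n : ℕ} {M : ℝ}

/-- The multicast codeword `Y_d` sent for the library `x` under demand `d`. -/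
def codeword (S : Scheme 𝒳 n M) (d : Demand) (x : Library 𝒳 n) : List Bool :=
  S.encode d (fun i => S.cache i x) x

/-- The reconstruction by receiver `i` of the file `d i` that it requested. -/
def reconstruction (S : Scheme 𝒳 n M) (d : Demand) (i : Fin 2) (x : Library 𝒳 n) :
    Fin n → 𝒳 (d i) :=
  S.decode i d (S.codeword d x) (S.cache i x)

variable [∀ j, Fintype (𝒳 j)]

open Classical in
/-- Worst-case (over demands and receivers) probability of error. -/
def errorProb (p : PMF ((j : Fin 2) → 𝒳 j)) (S : Scheme 𝒳 n M) : ℝ :=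
  ⨆ d : Demand, ⨆ i : Fin 2,
    ∑ x : Library 𝒳 n, if S.reconstruction d i x ≠ x (d i) then libraryProb p x else 0

/-- Peak multicast rate: the worst-case expected codeword length in bits per source symbol. -/
def peakRate (p : PMF ((j : Fin 2) → 𝒳 j)) (S : Scheme 𝒳 n M) : ℝ :=
  ⨆ d : Demand,
    (∑ x : Library 𝒳 n, libraryProb p x * ((S.codeword d x).length : ℝ)) / (n : ℝ)

end Scheme

variable {𝒳 : Fin 2 → Type*} [∀ j, Fintype (𝒳 j)]

/-- `(R, M)` is achievable: there are schemes for cache capacity `M`, of increasing block lengths,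
with vanishing error probability and `limsup` of the peak rates at most `R`. The `limsup` is
taken in the extended reals. -/
def Achievable (p : PMF ((j : Fin 2) → 𝒳 j)) (R M : ℝ) : Prop :=
  ∃ (N : ℕ → ℕ) (S : (k : ℕ) → Scheme 𝒳 (N k) M), StrictMono N ∧
    Tendsto (fun k => (S k).errorProb p) atTop (𝓝 0) ∧
    limsup (fun k => (((S k).peakRate p : ℝ) : EReal)) atTop ≤ (R : EReal)

/-- The peak rate-memory region: closure of the set of achievable pairs `(R, M)`. -/
def region (p : PMF ((j : Fin 2) → 𝒳 j)) : Set (ℝ × ℝ) :=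
  closure {q | Achievable p q.1 q.2}

/-- The rates `R` with `(R, M)` in the peak rate-memory region. -/
def regionRates (p : PMF ((j : Fin 2) → 𝒳 j)) (M : ℝ) : Set ℝ :=
  {R | (R, M) ∈ region p}

/-- The optimal peak rate-memory function `R*(M)`. -/
def optimalRate (p : PMF ((j : Fin 2) → 𝒳 j)) (M : ℝ) : ℝ :=
  sInf (regionRates p M)

/-- The joint entropy `H(X₁, X₂)`. -/
def jointEntropy (p : PMF ((j : Fin 2) → 𝒳 j)) : ℝ := entropy p

/-- The entropy `H(X_j)` of one component of the source. -/
def fileEntropy (p : PMF ((j : Fin 2) → 𝒳 j)) (j : Fin 2) : ℝ :=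
  entropy (p.map fun x => x j)

/-- The lower bound `R^LB(M)`. -/
def lowerBound (p : PMF ((j : Fin 2) → 𝒳 j)) (M : ℝ) : ℝ :=
  sInf {R : ℝ |
    R ≥ jointEntropy p - 2 * M ∧
    R ≥ (1 / 2) * (jointEntropy p - M) ∧
    R ≥ (1 / 2) * (jointEntropy p + max (fileEntropy p 0) (fileEntropy p 1)) - M}

end

end CodedCaching

/-! The converse is a cut-set argument with one use of submodularity. Some receiver views determine
both files up to Fano's error: one codeword with both caches, or two codewords with one cache.
Bounding the entropy of these views by codeword and cache sizes gives the first two inequalities.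
For the third, two views that each reveal $X_j$ are merged by submodularity (`ent_prod_add_le`),
which leaves $H(X_j)$ on the lower side.

All entropy inequalities except monotonicity come from Gibbs' inequality `ent_le_of_sum_le` with a
suitable weight $q$. Codewords need not be prefix-free, so $H(Y)\le E[L]$ may fail;
`ent_le_expected_length` loses a factor tending to 1 and a constant independent of $n$. Dividing by
$n$ and then letting the slack vanish gives linear bounds on achievable pairs. These bounds are
closed conditions, so they pass to the region. An uncompressed scheme makes the set of rates
nonempty. -/

namespace CodedCaching

noncomputable section

/-! ### Entropy inequalities over a finite weighted space -/

section Entropy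

variable {Ω α β γ : Type*} [Fintype Ω] {μ : Ω → ℝ}

open Classical in
/-- The law of `f` under the weights `μ`. -/
def law (μ : Ω → ℝ) (f : Ω → α) (a : α) : ℝ := ∑ x, if f x = a then μ x else 0

/-- The entropy, in nats, of `f` under the weights `μ`. -/
def ent (μ : Ω → ℝ) (f : Ω → α) : ℝ := -∑ x, μ x * Real.log (law μ f (f x))

lemma law_nonneg (hμ : ∀ x, 0 ≤ μ x) (f : Ω → α) (a : α) : 0 ≤ law μ f a :=
  Finset.sum_nonneg fun x _ => by split_ifs <;> simp [hμ]

lemma le_law (hμ : ∀ x, 0 ≤ μ x) (f : Ω → α) (x : Ω) : μ x ≤ law μ f (f x) := by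
  classical
  have := Finset.single_le_sum (f := fun y => if f y = f x then μ y else 0)
    (fun y _ => by split_ifs <;> simp [hμ]) (Finset.mem_univ x)
  simpa [law] using this

lemma law_le_law (hμ : ∀ x, 0 ≤ μ x) {f : Ω → α} {g : Ω → β}
    (h : ∀ x y, g x = g y → f x = f y) (x : Ω) : law μ g (g x) ≤ law μ f (f x) := by
  classical
  refine Finset.sum_le_sum fun y _ => ?_
  by_cases hy : g y = g x
  · simp [hy, h y x hy]
  · rw [if_neg hy]
    split_ifs <;> simp [hμ]

/-- The hypothesis makes `f` a function of `g`, so the fibres of `f` are larger. -/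
lemma ent_mono (hμ : ∀ x, 0 ≤ μ x) {f : Ω → α} {g : Ω → β}
    (h : ∀ x y, g x = g y → f x = f y) : ent μ f ≤ ent μ g := by
  refine neg_le_neg (Finset.sum_le_sum fun x _ => ?_)
  rcases (hμ x).eq_or_lt with h0 | h0
  · simp [← h0]
  · exact mul_le_mul_of_nonneg_left
      (Real.log_le_log (h0.trans_le (le_law hμ g x)) (law_le_law hμ h x)) h0.le

open Classical in
-- Summing over the finite image of `f` allows `α` to be infinite, as for `List Bool`.
lemma sum_mul_comp (f : Ω → α) (φ : α → ℝ) :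
    ∑ x, μ x * φ (f x) = ∑ a ∈ Finset.univ.image f, law μ f a * φ a := by
  rw [← Finset.sum_fiberwise_of_maps_to (g := f) (t := Finset.univ.image f)
    (fun x _ => Finset.mem_image_of_mem f (Finset.mem_univ x))]
  refine Finset.sum_congr rfl fun a _ => ?_
  rw [law, ← Finset.sum_filter, Finset.sum_mul]
  refine Finset.sum_congr rfl fun x hx => ?_
  rw [(Finset.mem_filter.mp hx).2]

open Classical in
lemma sum_law (h1 : ∑ x, μ x = 1) (f : Ω → α) : ∑ a ∈ Finset.univ.image f, law μ f a = 1 := by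
  simpa [h1] using (sum_mul_comp (μ := μ) f fun _ => 1).symm

open Classical in
lemma sum_law_prod (f : Ω → α) (h : Ω → γ) (c : γ) :
    ∑ a ∈ Finset.univ.image f, law μ (fun x => (f x, h x)) (a, c) = law μ h c := by
  unfold law
  rw [Finset.sum_comm]
  refine Finset.sum_congr rfl fun x _ => ?_
  by_cases hc : h x = c
  · simp [hc]
  · simp [hc]

open Classical in
/-- Gibbs' inequality. -/
lemma ent_le_of_sum_le (hμ : ∀ x, 0 ≤ μ x) (h1 : ∑ x, μ x = 1) (f : Ω → α) (q : α → ℝ)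
    (hq : ∀ a, 0 ≤ q a) (hpos : ∀ x, 0 < μ x → 0 < q (f x)) {K : ℝ} (hK : 0 < K)
    (hsum : ∑ a ∈ Finset.univ.image f, q a ≤ K) :
    ent μ f ≤ -∑ x, μ x * Real.log (q (f x)) + Real.log K := by
  -- Pointwise $\log t\le t-1$ with $t=q/(PK)$, where $P$ is the law of `f`.
  have key : ∑ x, μ x * (Real.log (q (f x)) - Real.log (law μ f (f x)) - Real.log K)
      ≤ ∑ x, (μ x * (q (f x) / law μ f (f x) / K) - μ x) := by
    refine Finset.sum_le_sum fun x _ => ?_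
    rcases (hμ x).eq_or_lt with h0 | h0
    · simp [← h0]
    · have hP := h0.trans_le (le_law hμ f x)
      have hQ := hpos x h0
      rw [← Real.log_div hQ.ne' hP.ne', ← Real.log_div (div_pos hQ hP).ne' hK.ne']
      have := Real.log_le_sub_one_of_pos (div_pos (div_pos hQ hP) hK)
      nlinarith
  have hs : ∑ x, μ x * (q (f x) / law μ f (f x) / K) ≤ 1 := by
    rw [sum_mul_comp f fun a => q a / law μ f a / K]
    calc _ ≤ ∑ a ∈ Finset.univ.image f, q a / K := by
          refine Finset.sum_le_sum fun a _ => ?_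
          rcases (law_nonneg hμ f a).eq_or_lt with h0 | h0
          · simpa [← h0] using div_nonneg (hq a) hK.le
          · exact le_of_eq (by field_simp)
      _ ≤ 1 := by rw [← Finset.sum_div]; exact (div_le_one hK).2 hsum
  rw [Finset.sum_sub_distrib, h1] at key
  simp only [mul_sub, Finset.sum_sub_distrib, ← Finset.sum_mul, h1] at key
  unfold ent
  linarith

/-- Submodularity: Gibbs' inequality against the coupling $P(a,c)P(b,c)/P(c)$ that makes `f` and `g`
conditionally independent given `h`. -/
lemma ent_prod_add_le (hμ : ∀ x, 0 ≤ μ x) (h1 : ∑ x, μ x = 1)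
    (f : Ω → α) (g : Ω → β) (h : Ω → γ) :
    ent μ (fun x => (f x, g x, h x)) + ent μ h
      ≤ ent μ (fun x => (f x, h x)) + ent μ (fun x => (g x, h x)) := by
  classical
  set F := fun x => (f x, h x)
  set G := fun x => (g x, h x)
  let q : α × β × γ → ℝ := fun a => law μ F (a.1, a.2.2) * law μ G (a.2.1, a.2.2) / law μ h a.2.2
  have hq : ∀ a, 0 ≤ q a := fun a =>
    div_nonneg (mul_nonneg (law_nonneg hμ _ _) (law_nonneg hμ _ _)) (law_nonneg hμ _ _)
  have hF : ∀ x, 0 < μ x → 0 < law μ F (f x, h x) := fun x hx => hx.trans_le (le_law hμ F x)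
  have hG : ∀ x, 0 < μ x → 0 < law μ G (g x, h x) := fun x hx => hx.trans_le (le_law hμ G x)
  have hh : ∀ x, 0 < μ x → 0 < law μ h (h x) := fun x hx => hx.trans_le (le_law hμ h x)
  have hsum : ∑ a ∈ Finset.univ.image (fun x => (f x, g x, h x)), q a ≤ 1 := by
    calc _ ≤ ∑ a ∈ Finset.univ.image f ×ˢ Finset.univ.image g ×ˢ Finset.univ.image h, q a := by
          refine Finset.sum_le_sum_of_subset_of_nonneg ?_ fun a _ _ => hq a
          intro a ha
          obtain ⟨x, -, rfl⟩ := Finset.mem_image.mp ha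
          simp
      _ = ∑ c ∈ Finset.univ.image h, (∑ a ∈ Finset.univ.image f, law μ F (a, c))
            * (∑ b ∈ Finset.univ.image g, law μ G (b, c)) / law μ h c := by
          rw [Finset.sum_product]
          simp only [Finset.sum_product_right]
          rw [Finset.sum_comm]
          refine Finset.sum_congr rfl fun c _ => ?_
          rw [Finset.sum_mul_sum, Finset.sum_div]
          simp only [Finset.sum_div, q]
      _ = ∑ c ∈ Finset.univ.image h, law μ h c := by
          refine Finset.sum_congr rfl fun c _ => ?_
          rw [sum_law_prod f h, sum_law_prod g h]
          exact mul_self_div_self _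
      _ ≤ 1 := (sum_law h1 h).le
  have := ent_le_of_sum_le hμ h1 (fun x => (f x, g x, h x)) q hq
    (fun x hx => div_pos (mul_pos (hF x hx) (hG x hx)) (hh x hx)) one_pos (by convert hsum)
  have e : ∑ x, μ x * Real.log (q (f x, g x, h x))
      = ∑ x, μ x * Real.log (law μ F (F x)) + ∑ x, μ x * Real.log (law μ G (G x))
        - ∑ x, μ x * Real.log (law μ h (h x)) := by
    rw [← Finset.sum_add_distrib, ← Finset.sum_sub_distrib]
    refine Finset.sum_congr rfl fun x _ => ?_
    rcases (hμ x).eq_or_lt with h0 | h0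
    · simp [← h0]
    · rw [Real.log_div (mul_pos (hF x h0) (hG x h0)).ne' (hh x h0).ne',
        Real.log_mul (hF x h0).ne' (hG x h0).ne']
      ring
  rw [e, Real.log_one] at this
  unfold ent at *
  linarith

lemma ent_nonneg (hμ : ∀ x, 0 ≤ μ x) (h1 : ∑ x, μ x = 1) (f : Ω → α) : 0 ≤ ent μ f := by
  classical
  rw [ent, ← Finset.sum_neg_distrib]
  refine Finset.sum_nonneg fun x _ => ?_
  rw [← mul_neg]
  refine mul_nonneg (hμ x) (neg_nonneg.2 (Real.log_nonpos (law_nonneg hμ _ _) ?_))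
  rw [← h1]
  exact Finset.sum_le_sum fun y _ => by split_ifs <;> simp [hμ]

lemma ent_prod_le (hμ : ∀ x, 0 ≤ μ x) (h1 : ∑ x, μ x = 1) (f : Ω → α) (g : Ω → β) :
    ent μ (fun x => (f x, g x)) ≤ ent μ f + ent μ g := by
  have a := ent_prod_add_le hμ h1 f g (fun _ => ())
  have b := ent_nonneg hμ h1 (fun _ : Ω => ())
  have c : ent μ (fun x => (f x, g x)) ≤ ent μ (fun x => (f x, g x, ())) :=
    ent_mono hμ (by simp)
  have d : ent μ (fun x => (f x, ())) ≤ ent μ f := ent_mono hμ (by simp)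
  have e : ent μ (fun x => (g x, ())) ≤ ent μ g := ent_mono hμ (by simp)
  linarith

lemma ent_le_log_card [Fintype α] (hμ : ∀ x, 0 ≤ μ x) (h1 : ∑ x, μ x = 1) (f : Ω → α) :
    ent μ f ≤ Real.log (Fintype.card α) := by
  classical
  have hne : Nonempty Ω := by
    by_contra h
    rw [not_nonempty_iff] at h
    simp at h1
  have : Nonempty α := hne.map f
  have := ent_le_of_sum_le hμ h1 f (fun _ => 1) (fun _ => zero_le_one) (fun _ _ => one_pos)
    (K := Fintype.card α) (by exact_mod_cast Fintype.card_pos)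
    (by simpa using (Finset.univ.image f).card_le_univ)
  simpa using this

open Classical in
/-- Fano's inequality. -/
lemma ent_prod_le_of_estimator [Fintype β] (hμ : ∀ x, 0 ≤ μ x) (h1 : ∑ x, μ x = 1)
    (W : Ω → α) (X : Ω → β) (g : α → β) :
    ent μ (fun x => (W x, X x)) ≤ ent μ W
      + (∑ x, if g (W x) ≠ X x then μ x else 0) * Real.log (Fintype.card β) + Real.log 2 := by
  have hne : Nonempty Ω := by
    by_contra h
    rw [not_nonempty_iff] at h
    simp at h1
  have : Nonempty β := hne.map X
  have hc : (0 : ℝ) < Fintype.card β := by exact_mod_cast Fintype.card_pos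
  -- Full weight on the estimate and uniform weight elsewhere: the total is at most 2, and `Real.log
  -- 2` replaces the binary entropy in Fano's bound.
  let u : α × β → ℝ := fun a => if g a.1 = a.2 then 1 else (Fintype.card β : ℝ)⁻¹
  have hu : ∀ a, 0 < u a := fun a => by dsimp only [u]; split_ifs <;> positivity
  have hW : ∀ x, 0 < μ x → 0 < law μ W (W x) := fun x hx => hx.trans_le (le_law hμ W x)
  have hsum : ∑ a ∈ Finset.univ.image (fun x => (W x, X x)), law μ W a.1 * u a ≤ 2 := by
    calc _ ≤ ∑ a ∈ Finset.univ.image W ×ˢ Finset.univ, law μ W a.1 * u a := by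
          refine Finset.sum_le_sum_of_subset_of_nonneg ?_
            fun a _ _ => mul_nonneg (law_nonneg hμ _ _) (hu a).le
          intro a ha
          obtain ⟨x, -, rfl⟩ := Finset.mem_image.mp ha
          simp
      _ = ∑ w ∈ Finset.univ.image W, law μ W w * ∑ b, u (w, b) := by
          rw [Finset.sum_product]
          simp only [Finset.mul_sum]
      _ ≤ ∑ w ∈ Finset.univ.image W, law μ W w * 2 := by
          refine Finset.sum_le_sum fun w _ => mul_le_mul_of_nonneg_left ?_ (law_nonneg hμ _ _)
          calc ∑ b, u (w, b) ≤ ∑ b, ((if g w = b then 1 else 0) + (Fintype.card β : ℝ)⁻¹) := by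
                refine Finset.sum_le_sum fun b _ => ?_
                dsimp only [u]
                split_ifs
                · simp
                · simp
            _ = 2 := by
                rw [Finset.sum_add_distrib]
                simp [hc.ne']
                norm_num
      _ = 2 := by rw [← Finset.sum_mul, sum_law h1, one_mul]
  have := ent_le_of_sum_le hμ h1 (fun x => (W x, X x)) (fun a => law μ W a.1 * u a)
    (fun a => mul_nonneg (law_nonneg hμ _ _) (hu a).le)
    (fun x hx => mul_pos (hW x hx) (hu _)) two_pos (by convert hsum)
  have e : ∑ x, μ x * Real.log (law μ W (W x) * u (W x, X x))
      = ∑ x, μ x * Real.log (law μ W (W x))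
        - (∑ x, if g (W x) ≠ X x then μ x else 0) * Real.log (Fintype.card β) := by
    rw [Finset.sum_mul, ← Finset.sum_sub_distrib]
    refine Finset.sum_congr rfl fun x _ => ?_
    rcases (hμ x).eq_or_lt with h0 | h0
    · simp [← h0]
    · rw [Real.log_mul (hW x h0).ne' (hu _).ne']
      by_cases hx : g (W x) = X x
      · simp [u, hx]
      · simp [u, hx]
        ring
  simp only [e] at this
  unfold ent at *
  linarith

/-- There are at most $2^l$ strings of length $l$, so a geometric series dominates. -/
lemma sum_pow_length_le (T : Finset (List Bool)) {r : ℝ} (h0 : 0 ≤ r) (h1 : r < 1) :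
    ∑ y ∈ T, (r / 2) ^ y.length ≤ (1 - r)⁻¹ := by
  classical
  have hfib : ∀ l, (T.filter fun y => y.length = l).card ≤ 2 ^ l := fun l => by
    have : (T.filter fun y => y.length = l) ⊆
        (Finset.univ : Finset (Fin l → Bool)).image List.ofFn := by
      intro y hy
      obtain ⟨-, rfl⟩ := Finset.mem_filter.mp hy
      exact Finset.mem_image.2 ⟨y.get, Finset.mem_univ _, List.ofFn_get y⟩
    exact (Finset.card_le_card this).trans (Finset.card_image_le.trans (by simp))
  rw [← Finset.sum_fiberwise_of_maps_to (g := List.length) (t := T.image List.length)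
    (fun y hy => Finset.mem_image_of_mem _ hy)]
  calc _ ≤ ∑ l ∈ T.image List.length, r ^ l := by
        refine Finset.sum_le_sum fun l _ => ?_
        have : ∑ y ∈ T.filter (fun y => y.length = l), (r / 2) ^ y.length
            = ((T.filter fun y => y.length = l).card : ℝ) * (r / 2) ^ l := by
          rw [← nsmul_eq_mul, ← Finset.sum_const]
          exact Finset.sum_congr rfl fun y hy => by rw [(Finset.mem_filter.mp hy).2]
        rw [this]
        calc _ ≤ (2 : ℝ) ^ l * (r / 2) ^ l := by
              gcongr
              exact_mod_cast hfib l
          _ = r ^ l := by rw [← mul_pow]; congr 1; ring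
    _ ≤ ∑' l, r ^ l := (summable_geometric_of_lt_one h0 h1).sum_le_tsum _
        fun l _ => pow_nonneg h0 l
    _ = (1 - r)⁻¹ := tsum_geometric_of_lt_one h0 h1

/-- Entropy of a variable-length binary string against its expected length. -/
lemma ent_le_expected_length (hμ : ∀ x, 0 ≤ μ x) (h1 : ∑ x, μ x = 1) (Y : Ω → List Bool)
    {δ : ℝ} (hδ : 0 < δ) :
    ent μ Y ≤ (Real.log 2 + δ) * ∑ x, μ x * ((Y x).length : ℝ)
      + Real.log (1 - Real.exp (-δ))⁻¹ := by
  have hr : Real.exp (-δ) < 1 := by simpa using hδ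
  -- Over all strings the weights $2^{-L}$ have infinite sum; the damping $e^{-\delta L}$ makes it
  -- finite.
  have := ent_le_of_sum_le hμ h1 Y (fun y => (Real.exp (-δ) / 2) ^ y.length)
    (fun y => by positivity) (fun x _ => by positivity) (inv_pos.2 (sub_pos.2 hr))
    (sum_pow_length_le _ (Real.exp_pos _).le hr)
  refine this.trans_eq ?_
  congr 1
  rw [Finset.mul_sum, ← Finset.sum_neg_distrib]
  refine Finset.sum_congr rfl fun x _ => ?_
  rw [Real.log_pow, Real.log_div (Real.exp_pos _).ne' two_ne_zero, Real.log_exp]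
  ring

end Entropy

/-! ### Entropy of i.i.d. blocks, and the passage between nats and bits -/

section IID

variable {A : Type*} [Fintype A]

lemma sum_toReal_pmf (p : PMF A) : ∑ a, (p a).toReal = 1 := by
  rw [← ENNReal.toReal_sum fun a _ => p.apply_ne_top a, ← tsum_fintype (L := .unconditional _),
    p.tsum_coe, ENNReal.toReal_one]

lemma sum_prod_mul_apply {n : ℕ} {w : A → ℝ} (h1 : ∑ a, w a = 1) (φ : A → ℝ) (s : Fin n) :
    ∑ x : Fin n → A, (∏ t, w (x t)) * φ (x s) = ∑ a, w a * φ a := by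
  classical
  have e : ∀ x : Fin n → A, (∏ t, w (x t)) * φ (x s)
      = ∏ t, w (x t) * (if t = s then φ (x t) else 1) := fun x => by
    rw [Finset.prod_mul_distrib]
    simp
  simp only [e]
  rw [← Fintype.prod_sum (fun t a => w a * (if t = s then φ a else 1))]
  rw [Finset.prod_eq_single s]
  · simp
  · intro t _ ht
    simp [ht, h1]
  · simp

lemma law_iid {B : Type*} {n : ℕ} (w : A → ℝ) (f : A → B) (y : Fin n → B) :
    law (fun x : Fin n → A => ∏ t, w (x t)) (fun x t => f (x t)) y = ∏ t, law w f (y t) := by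
  classical
  unfold law
  rw [Fintype.prod_sum]
  refine Finset.sum_congr rfl fun x _ => ?_
  by_cases h : ∀ t, f (x t) = y t
  · rw [if_pos (funext h)]
    exact Finset.prod_congr rfl fun t _ => by rw [if_pos (h t)]
  · rw [if_neg fun h' => h (congrFun h')]
    push Not at h
    obtain ⟨t, ht⟩ := h
    exact (Finset.prod_eq_zero (Finset.mem_univ t) (by rw [if_neg ht])).symm

/-- The law factorises, so its logarithm is a sum of $n$ terms with equal expectations. -/
lemma ent_iid {B : Type*} {n : ℕ} {w : A → ℝ} (hw : ∀ a, 0 ≤ w a) (h1 : ∑ a, w a = 1)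
    (f : A → B) :
    ent (fun x : Fin n → A => ∏ t, w (x t)) (fun x t => f (x t)) = n * ent w f := by
  have e : ∀ x : Fin n → A, (∏ t, w (x t)) * Real.log (∏ t, law w f (f (x t)))
      = ∑ s, (∏ t, w (x t)) * Real.log (law w f (f (x s))) := fun x => by
    rcases (Finset.prod_nonneg fun t (_ : t ∈ Finset.univ) => hw (x t)).eq_or_lt with h0 | h0
    · simp [← h0]
    · rw [← Finset.mul_sum, Real.log_prod]
      intro t _
      have : w (x t) ≠ 0 := Finset.prod_ne_zero_iff.mp h0.ne' t (Finset.mem_univ t)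
      exact (((hw _).lt_of_ne' this).trans_le (le_law hw f (x t))).ne'
  unfold ent
  simp only [law_iid, e]
  rw [Finset.sum_comm]
  simp [sum_prod_mul_apply h1 (fun a => Real.log (law w f (f a)))]

lemma ent_id_eq_entropy (p : PMF A) :
    ent (fun a => (p a).toReal) id = entropy p * Real.log 2 := by
  classical
  have h2 : Real.log 2 ≠ 0 := (Real.log_pos one_lt_two).ne'
  rw [entropy, ← Finset.sum_div, div_mul_cancel₀ _ h2, ent, ← Finset.sum_neg_distrib]
  refine Finset.sum_congr rfl fun a _ => ?_
  have : law (fun a => (p a).toReal) id a = (p a).toReal := by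
    simp only [law, id]
    rw [Finset.sum_ite_eq' Finset.univ a, if_pos (Finset.mem_univ a)]
  rw [id, this, Real.negMulLog, neg_mul]

lemma toReal_map_apply {B : Type*} (p : PMF A) (f : A → B) (b : B) :
    (p.map f b).toReal = law (fun a => (p a).toReal) f b := by
  classical
  rw [PMF.map_apply, tsum_fintype (L := .unconditional _), ENNReal.toReal_sum]
  · refine Finset.sum_congr rfl fun a _ => ?_
    by_cases h : f a = b
    · rw [if_pos h, if_pos h.symm]
    · rw [if_neg h, if_neg (Ne.symm h), ENNReal.toReal_zero]
  · intro a _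
    split_ifs
    · exact p.apply_ne_top a
    · simp

lemma ent_eq_entropy_map {B : Type*} [Fintype B] (p : PMF A) (f : A → B) :
    ent (fun a => (p a).toReal) f = entropy (p.map f) * Real.log 2 := by
  classical
  rw [← ent_id_eq_entropy, ent, ent]
  rw [sum_mul_comp f fun b => Real.log (law (fun a => (p a).toReal) f b)]
  congr 1
  have e : ∀ b, law (fun b => (p.map f b).toReal) id (id b) = law (fun a => (p a).toReal) f b :=
    fun b => by
      rw [← toReal_map_apply p f b]
      simp only [law, id]
      rw [Finset.sum_ite_eq' Finset.univ b, if_pos (Finset.mem_univ b)]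
  simp only [e]
  simp only [toReal_map_apply]
  refine Finset.sum_subset (Finset.subset_univ _) fun b _ hb => ?_
  have : law (fun a => (p a).toReal) f b = 0 := Finset.sum_eq_zero fun a _ => by
    rw [if_neg]
    rintro rfl
    exact hb (Finset.mem_image_of_mem f (Finset.mem_univ a))
  rw [this, zero_mul]

lemma ent_comp_equiv {Ω Ω' α : Type*} [Fintype Ω] [Fintype Ω'] (e : Ω ≃ Ω') (μ : Ω' → ℝ)
    (f : Ω' → α) : ent (fun x => μ (e x)) (fun x => f (e x)) = ent μ f := by
  classical
  have h : ∀ a, law (fun x => μ (e x)) (fun x => f (e x)) a = law μ f a := fun a =>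
    Equiv.sum_comp e fun x => if f x = a then μ x else 0
  unfold ent
  simp only [h]
  congr 1
  exact Equiv.sum_comp e fun x => μ x * Real.log (law μ f (f x))

end IID

/-! ### Entropies of the library -/

section Source

variable {𝒳 : Fin 2 → Type*} (p : PMF ((j : Fin 2) → 𝒳 j)) {n : ℕ}

lemma libraryProb_nonneg (x : Library 𝒳 n) : 0 ≤ libraryProb p x :=
  Finset.prod_nonneg fun _ _ => ENNReal.toReal_nonneg

variable [∀ j, Fintype (𝒳 j)]

lemma sum_libraryProb : ∑ x : Library 𝒳 n, libraryProb p x = 1 := by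
  classical
  have := Equiv.sum_comp (Equiv.piComm fun (j : Fin 2) (_ : Fin n) => 𝒳 j)
    fun x => ∏ t, (p (x t)).toReal
  refine Eq.trans this ?_
  rw [← Fintype.prod_sum fun (_ : Fin n) a => (p a).toReal]
  simp [sum_toReal_pmf]

lemma ent_library {B : Type*} (f : ((j : Fin 2) → 𝒳 j) → B) :
    ent (libraryProb p) (fun (x : Library 𝒳 n) t => f fun j => x j t)
      = n * ent (fun a => (p a).toReal) f := by
  rw [← ent_iid (fun _ => ENNReal.toReal_nonneg) (sum_toReal_pmf p) f]
  exact ent_comp_equiv (Equiv.piComm fun (j : Fin 2) (_ : Fin n) => 𝒳 j)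
    (fun x => ∏ t, (p (x t)).toReal) fun x t => f (x t)

lemma ent_library_joint :
    ent (libraryProb p) (fun (x : Library 𝒳 n) t j => x j t)
      = n * (jointEntropy p * Real.log 2) := by
  rw [jointEntropy, ← ent_id_eq_entropy, ← ent_library]
  rfl

lemma ent_library_file (j : Fin 2) :
    ent (libraryProb p) (fun x : Library 𝒳 n => x j) = n * (fileEntropy p j * Real.log 2) := by
  rw [fileEntropy, ← ent_eq_entropy_map, ← ent_library]

end Source

/-! ### Converse inequalities for a single scheme -/

namespace Scheme

variable {𝒳 : Fin 2 → Type*} [∀ j, Fintype (𝒳 j)] {p : PMF ((j : Fin 2) → 𝒳 j)} {n : ℕ} {M : ℝ}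
  (S : Scheme 𝒳 n M)

lemma ent_cache_le (i : Fin 2) : ent (libraryProb p) (S.cache i) ≤ n * (M * Real.log 2) := by
  -- The sign of `M` is free here; the index set is nonempty because the scheme maps a library into
  -- it.
  have hpos : 0 < ⌊(2 : ℝ) ^ ((n : ℝ) * M)⌋₊ := by
    have : Nonempty (Library 𝒳 n) := by
      by_contra h
      rw [not_nonempty_iff] at h
      simpa using sum_libraryProb p (n := n)
    exact (S.cache i this.some).pos
  refine (ent_le_log_card (libraryProb_nonneg p) (sum_libraryProb p) _).trans ?_
  rw [Fintype.card_fin]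
  calc _ ≤ Real.log ((2 : ℝ) ^ ((n : ℝ) * M)) :=
        Real.log_le_log (by exact_mod_cast hpos) (Nat.floor_le (by positivity))
    _ = _ := by rw [Real.log_rpow two_pos]; ring

lemma expected_length_le (hn : 0 < n) (d : Demand) :
    ∑ x : Library 𝒳 n, libraryProb p x * ((S.codeword d x).length : ℝ) ≤ n * S.peakRate p := by
  have hn' : (0 : ℝ) < n := by exact_mod_cast hn
  rw [mul_comm, ← div_le_iff₀ hn']
  exact le_ciSup (f := fun d => (∑ x : Library 𝒳 n,
    libraryProb p x * ((S.codeword d x).length : ℝ)) / (n : ℝ)) (Set.finite_range _).bddAbove d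

lemma ent_codeword_le (hn : 0 < n) (d : Demand) {δ : ℝ} (hδ : 0 < δ) :
    ent (libraryProb p) (S.codeword d) ≤ (Real.log 2 + δ) * (n * S.peakRate p)
      + Real.log (1 - Real.exp (-δ))⁻¹ := by
  refine (ent_le_expected_length (libraryProb_nonneg p) (sum_libraryProb p) _ hδ).trans ?_
  have := Real.log_pos one_lt_two
  gcongr
  exact S.expected_length_le hn d

open Classical in
lemma error_le_errorProb (d : Demand) (i : Fin 2) :
    (∑ x : Library 𝒳 n, if S.reconstruction d i x ≠ x (d i) then libraryProb p x else 0)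
      ≤ S.errorProb p := by
  let F : Demand → Fin 2 → ℝ := fun d i =>
    ∑ x : Library 𝒳 n, if S.reconstruction d i x ≠ x (d i) then libraryProb p x else 0
  exact (le_ciSup (f := F d) (Set.finite_range _).bddAbove i).trans
    (le_ciSup (f := fun d => ⨆ i, F d i) (Set.finite_range _).bddAbove d)

lemma errorProb_nonneg : 0 ≤ S.errorProb p := by
  classical
  exact le_trans (Finset.sum_nonneg fun x _ => by
    split_ifs <;> simp [libraryProb_nonneg]) (S.error_le_errorProb 0 0)

variable (𝒳) in
/-- The sum of the log-sizes, in nats, of the two alphabets. -/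
def alphabetSize : ℝ := ∑ j, Real.log (Fintype.card (𝒳 j))

lemma log_card_le (j : Fin 2) :
    Real.log (Fintype.card (Fin n → 𝒳 j)) ≤ n * alphabetSize 𝒳 := by
  classical
  rw [Fintype.card_fun, Fintype.card_fin, Nat.cast_pow, Real.log_pow]
  gcongr
  exact Finset.single_le_sum (f := fun j => Real.log (Fintype.card (𝒳 j)))
    (fun j _ => Real.log_natCast_nonneg _) (Finset.mem_univ j)

/-- Adjoining a requested file to what a receiver sees costs little entropy. -/
lemma ent_prod_file_le {α : Type*} (W : Library 𝒳 n → α) (d : Demand) (i : Fin 2)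
    (g : α → List Bool × CacheContent n M)
    (hg : ∀ x, g (W x) = (S.codeword d x, S.cache i x)) :
    ent (libraryProb p) (fun x => (W x, x (d i))) ≤ ent (libraryProb p) W
      + S.errorProb p * (n * alphabetSize 𝒳) + Real.log 2 := by
  classical
  have := ent_prod_le_of_estimator (libraryProb_nonneg p) (sum_libraryProb p) W
    (fun x => x (d i)) (fun a => S.decode i d (g a).1 (g a).2)
  simp only [hg] at this
  refine this.trans ?_
  have := mul_le_mul (S.error_le_errorProb (p := p) d i) (log_card_le (𝒳 := 𝒳) (n := n) (d i))
    (Real.log_natCast_nonneg _) S.errorProb_nonneg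
  simp only [reconstruction] at this
  refine add_le_add (add_le_add le_rfl ?_) le_rfl
  convert this
  exact if_congr Iff.rfl rfl rfl

lemma joint_le_of_determines {α : Type*} (W : Library 𝒳 n → α) {j j' : Fin 2} (hj : j ≠ j')
    (h0 : ∀ x y, W x = W y → x j = y j) (h1 : ∀ x y, W x = W y → x j' = y j') :
    n * (jointEntropy p * Real.log 2) ≤ ent (libraryProb p) W := by
  rw [← ent_library_joint]
  refine ent_mono (libraryProb_nonneg p) fun x y h => ?_
  have : x = y := funext fun k => by
    have : k = j ∨ k = j' := by omega
    rcases this with rfl | rfl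
    exacts [h0 x y h, h1 x y h]
  rw [this]

/-- When the receivers request different files, one codeword and both caches recover the library. -/
lemma joint_le_two_caches (hn : 0 < n) {δ : ℝ} (hδ : 0 < δ) :
    n * (jointEntropy p * Real.log 2) ≤ 1 * (Real.log 2 + δ) * (n * S.peakRate p)
      + n * (2 * M * Real.log 2)
      + (Real.log (1 - Real.exp (-δ))⁻¹ + 2 * Real.log 2)
      + 2 * (S.errorProb p * (n * alphabetSize 𝒳)) := by
  have hμ := libraryProb_nonneg p (n := n)
  have h1 := sum_libraryProb p (n := n)
  let d : Demand := ![0, 1]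
  have a1 := ent_prod_le hμ h1 (S.cache 0) (S.cache 1)
  have a2 := ent_prod_le hμ h1 (S.codeword d) (fun x => (S.cache 0 x, S.cache 1 x))
  have a3 := S.ent_prod_file_le (p := p)
    (fun x => (S.codeword d x, S.cache 0 x, S.cache 1 x)) d 0 (fun a => (a.1, a.2.1)) fun _ => rfl
  have a4 := S.ent_prod_file_le (p := p)
    (fun x => ((S.codeword d x, S.cache 0 x, S.cache 1 x), x (d 0))) d 1
    (fun a => (a.1.1, a.1.2.2)) fun _ => rfl
  have a5 := joint_le_of_determines (p := p)
    (fun x : Library 𝒳 n => (((S.codeword d x, S.cache 0 x, S.cache 1 x), x (d 0)), x (d 1)))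
    (j := d 0) (j' := d 1) (by simp [d]) (fun x y h => (Prod.ext_iff.1 (Prod.ext_iff.1 h).1).2)
    (fun x y h => (Prod.ext_iff.1 h).2)
  have b1 := S.ent_codeword_le (p := p) hn d hδ
  have b2 := S.ent_cache_le (p := p) 0
  have b3 := S.ent_cache_le (p := p) 1
  linarith

/-- Receiver 0 alone recovers the library from its cache and the codewords of two opposite demands.
-/
lemma joint_le_two_codewords (hn : 0 < n) {δ : ℝ} (hδ : 0 < δ) :
    n * (jointEntropy p * Real.log 2) ≤ 2 * (Real.log 2 + δ) * (n * S.peakRate p)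
      + n * (M * Real.log 2)
      + (2 * Real.log (1 - Real.exp (-δ))⁻¹ + 2 * Real.log 2)
      + 2 * (S.errorProb p * (n * alphabetSize 𝒳)) := by
  have hμ := libraryProb_nonneg p (n := n)
  have h1 := sum_libraryProb p (n := n)
  let d : Demand := ![0, 1]
  let d' : Demand := ![1, 0]
  have a1 := ent_prod_le hμ h1 (S.codeword d') (S.cache 0)
  have a2 := ent_prod_le hμ h1 (S.codeword d) (fun x => (S.codeword d' x, S.cache 0 x))
  have a3 := S.ent_prod_file_le (p := p)
    (fun x => (S.codeword d x, S.codeword d' x, S.cache 0 x)) d 0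
    (fun a => (a.1, a.2.2)) fun _ => rfl
  have a4 := S.ent_prod_file_le (p := p)
    (fun x => ((S.codeword d x, S.codeword d' x, S.cache 0 x), x (d 0))) d' 0
    (fun a => (a.1.2.1, a.1.2.2)) fun _ => rfl
  have a5 := joint_le_of_determines (p := p)
    (fun x : Library 𝒳 n => (((S.codeword d x, S.codeword d' x, S.cache 0 x), x (d 0)), x (d' 0)))
    (j := d 0) (j' := d' 0) (by simp [d, d'])
    (fun x y h => (Prod.ext_iff.1 (Prod.ext_iff.1 h).1).2) (fun x y h => (Prod.ext_iff.1 h).2)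
  have b1 := S.ent_codeword_le (p := p) hn d hδ
  have b2 := S.ent_codeword_le (p := p) hn d' hδ
  have b3 := S.ent_cache_le (p := p) 0
  linarith

/-- `U` and `V` each reveal file `j`, to receiver 0 under `d` and to receiver 1 under `d'`.
Submodularity given that file leaves its entropy and the joint view, where the codeword from `U` and
the cache from `V` yield the other file. -/
lemma joint_add_file_le (hn : 0 < n) (j : Fin 2) {δ : ℝ} (hδ : 0 < δ) :
    n * ((jointEntropy p + fileEntropy p j) * Real.log 2)
      ≤ 2 * (Real.log 2 + δ) * (n * S.peakRate p)
      + n * (2 * M * Real.log 2)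
      + (2 * Real.log (1 - Real.exp (-δ))⁻¹ + 3 * Real.log 2)
      + 3 * (S.errorProb p * (n * alphabetSize 𝒳)) := by
  have hμ := libraryProb_nonneg p (n := n)
  have h1 := sum_libraryProb p (n := n)
  let d : Demand := ![j, 1 - j]
  let d' : Demand := ![1 - j, j]
  let U : Library 𝒳 n → _ := fun x => (S.codeword d x, S.cache 0 x)
  let V : Library 𝒳 n → _ := fun x => (S.codeword d' x, S.cache 1 x)
  have a1 : ent (libraryProb p) U ≤ _ := ent_prod_le hμ h1 (S.codeword d) (S.cache 0)
  have a2 : ent (libraryProb p) V ≤ _ := ent_prod_le hμ h1 (S.codeword d') (S.cache 1)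
  have a3 : ent (libraryProb p) (fun x => (U x, x j)) ≤ _ :=
    S.ent_prod_file_le (p := p) U d 0 id fun _ => rfl
  have a4 : ent (libraryProb p) (fun x => (V x, x j)) ≤ _ :=
    S.ent_prod_file_le (p := p) V d' 1 id fun _ => rfl
  have a5 := ent_prod_add_le hμ h1 U V (fun x => x j)
  have a6 := S.ent_prod_file_le (p := p) (fun x => (U x, V x, x j)) d 1
    (fun a => (a.1.1, a.2.1.2)) fun _ => rfl
  have a7 := joint_le_of_determines (p := p)
    (fun x : Library 𝒳 n => ((U x, V x, x j), x (d 1))) (j := j) (j' := d 1)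
    (by simp only [d, Matrix.cons_val_one, Matrix.cons_val_fin_one]; omega)
    (fun x y h => (Prod.ext_iff.1 (Prod.ext_iff.1 (Prod.ext_iff.1 h).1).2).2)
    (fun x y h => (Prod.ext_iff.1 h).2)
  have a8 := ent_library_file p (n := n) j
  have b1 := S.ent_codeword_le (p := p) hn d hδ
  have b2 := S.ent_codeword_le (p := p) hn d' hδ
  have b3 := S.ent_cache_le (p := p) 0
  have b4 := S.ent_cache_le (p := p) 1
  linarith

end Scheme

/-! ### From schemes to the region, and nonemptiness -/

section Region

variable {𝒳 : Fin 2 → Type*} [∀ j, Fintype (𝒳 j)] {p : PMF ((j : Fin 2) → 𝒳 j)} {R M : ℝ}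

/-- A single-scheme inequality, uniform in the block length, passes to achievable pairs. -/
lemma Achievable.le_of_forall_scheme (h : Achievable p R M) {a k b A : ℝ} (hk : 0 ≤ k)
    (H : ∀ δ : ℝ, 0 < δ → ∃ C : ℝ, ∀ (n : ℕ), 0 < n → ∀ S : Scheme 𝒳 n M,
      n * a ≤ k * (Real.log 2 + δ) * (n * S.peakRate p) + n * b + C
        + A * (S.errorProb p * (n * Scheme.alphabetSize 𝒳))) :
    a ≤ k * Real.log 2 * R + b := by
  obtain ⟨N, S, hN, he, hR⟩ := h
  have hlog := Real.log_pos one_lt_two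
  -- The same `δ` serves as coding slack and as slack in the limsup. It stays fixed while the block
  -- length grows, since `C` depends on it.
  have step : ∀ δ : ℝ, 0 < δ → a ≤ k * (Real.log 2 + δ) * (R + δ) + b := by
    intro δ hδ
    obtain ⟨C, hC⟩ := H δ hδ
    have hNt : Tendsto (fun m => (N m : ℝ)) atTop atTop :=
      tendsto_natCast_atTop_atTop.comp hN.tendsto_atTop
    have hlim : Tendsto (fun m => k * (Real.log 2 + δ) * (R + δ) + b + C / (N m : ℝ)
        + A * ((S m).errorProb p * Scheme.alphabetSize 𝒳)) atTop
        (𝓝 (k * (Real.log 2 + δ) * (R + δ) + b + 0 + A * (0 * Scheme.alphabetSize 𝒳))) :=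
      (tendsto_const_nhds.add (tendsto_const_nhds.div_atTop hNt)).add
        ((he.mul_const _).const_mul A)
    have hev : ∀ᶠ m in atTop, (S m).peakRate p < R + δ := by
      have : limsup (fun m => (((S m).peakRate p : ℝ) : EReal)) atTop < ((R + δ : ℝ) : EReal) :=
        hR.trans_lt (by exact_mod_cast lt_add_of_pos_right R hδ)
      filter_upwards [eventually_lt_of_limsup_lt this] with m hm
      exact_mod_cast hm
    have := ge_of_tendsto hlim (b := a) (by
      filter_upwards [hev, hNt.eventually_gt_atTop 0] with m hm hpos
      have h1 := hC (N m) (by exact_mod_cast hpos) (S m)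
      have h2 : k * (Real.log 2 + δ) * (N m * (S m).peakRate p)
          ≤ k * (Real.log 2 + δ) * (N m * (R + δ)) := by gcongr
      refine le_of_mul_le_mul_left ?_ hpos
      have h3 : (N m : ℝ) * (C / N m) = C := by field_simp
      linear_combination h1 + h2 - h3)
    simpa using this
  have hlim : Tendsto (fun δ : ℝ => k * (Real.log 2 + δ) * (R + δ) + b) (𝓝[>] 0)
      (𝓝 (k * (Real.log 2 + 0) * (R + 0) + b)) := by
    refine Tendsto.mono_left (Continuous.tendsto (by fun_prop) 0) nhdsWithin_le_nhds
  have := ge_of_tendsto hlim (b := a) (by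
    filter_upwards [self_mem_nhdsWithin] with δ hδ using step δ hδ)
  simpa using this

lemma Achievable.joint_le_two_caches (h : Achievable p R M) :
    jointEntropy p - 2 * M ≤ R := by
  have hlog := Real.log_pos one_lt_two
  have := h.le_of_forall_scheme (A := 2) zero_le_one fun δ hδ =>
    ⟨_, fun n hn S => S.joint_le_two_caches hn hδ⟩
  refine le_of_mul_le_mul_right ?_ hlog
  linarith

lemma Achievable.joint_le_two_codewords (h : Achievable p R M) :
    1 / 2 * (jointEntropy p - M) ≤ R := by
  have hlog := Real.log_pos one_lt_two
  have := h.le_of_forall_scheme (A := 2) zero_le_two fun δ hδ =>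
    ⟨_, fun n hn S => S.joint_le_two_codewords hn hδ⟩
  refine le_of_mul_le_mul_right ?_ hlog
  linarith

lemma Achievable.joint_add_file_le (h : Achievable p R M) (j : Fin 2) :
    1 / 2 * (jointEntropy p + fileEntropy p j) - M ≤ R := by
  have hlog := Real.log_pos one_lt_two
  have := h.le_of_forall_scheme (A := 3) zero_le_two fun δ hδ =>
    ⟨_, fun n hn S => S.joint_add_file_le hn j hδ⟩
  refine le_of_mul_le_mul_right ?_ hlog
  linarith

/-- The closure moves `M` as well as `R`, so the bounds are used at every real capacity, negative
ones included. -/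
lemma regionRates_subset (p : PMF ((j : Fin 2) → 𝒳 j)) (M : ℝ) :
    regionRates p M ⊆ {R : ℝ |
      R ≥ jointEntropy p - 2 * M ∧
      R ≥ (1 / 2) * (jointEntropy p - M) ∧
      R ≥ (1 / 2) * (jointEntropy p + max (fileEntropy p 0) (fileEntropy p 1)) - M} := by
  let T : Set (ℝ × ℝ) := {q | jointEntropy p - 2 * q.2 ≤ q.1 ∧
    1 / 2 * (jointEntropy p - q.2) ≤ q.1 ∧
    1 / 2 * (jointEntropy p + max (fileEntropy p 0) (fileEntropy p 1)) - q.2 ≤ q.1}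
  have hT : IsClosed T := by
    simp only [T, Set.ofPred_and]
    refine IsClosed.inter ?_ (IsClosed.inter ?_ ?_) <;>
      exact isClosed_le (by fun_prop) (by fun_prop)
  have hsub : {q : ℝ × ℝ | Achievable p q.1 q.2} ⊆ T := fun q hq => by
    refine ⟨hq.joint_le_two_caches, hq.joint_le_two_codewords, ?_⟩
    rcases max_choice (fileEntropy p 0) (fileEntropy p 1) with e | e <;> rw [e]
    exacts [hq.joint_add_file_le 0, hq.joint_add_file_le 1]
  intro R hR
  exact closure_minimal hsub hT hR

open Classical in
/-- The scheme that ignores the caches and multicasts both files uncompressed, each symbol pair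
being described by the `Fintype.card` bits of its indicator function. -/
def uncompressedScheme [∀ j, Nonempty (𝒳 j)] (n : ℕ) {M : ℝ} (hM : 0 ≤ M) : Scheme 𝒳 n M where
  cache _ _ := ⟨0, Nat.floor_pos.2 (Real.one_le_rpow one_le_two (by positivity))⟩
  encode _ _ x := List.ofFn fun s : Fin (n * Fintype.card ((j : Fin 2) → 𝒳 j)) =>
    decide ((Fintype.equivFin ((j : Fin 2) → 𝒳 j)) (fun j => x j (finProdFinEquiv.symm s).1)
      = (finProdFinEquiv.symm s).2)
  decode i d y _ := fun t => Classical.epsilon fun a => ∃ b : (j : Fin 2) → 𝒳 j, b (d i) = a ∧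
    y[(finProdFinEquiv (t, Fintype.equivFin ((j : Fin 2) → 𝒳 j) b)).val]? = some true

lemma uncompressedScheme_reconstruction [∀ j, Nonempty (𝒳 j)] (n : ℕ) {M : ℝ} (hM : 0 ≤ M)
    (d : Demand) (i : Fin 2) (x : Library 𝒳 n) :
    (uncompressedScheme n hM : Scheme 𝒳 n M).reconstruction d i x = x (d i) := by
  classical
  funext t
  have key : ∀ a : 𝒳 (d i), (∃ b : (j : Fin 2) → 𝒳 j, b (d i) = a ∧
      ((uncompressedScheme n hM : Scheme 𝒳 n M).codeword d x)[(finProdFinEquiv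
        (t, Fintype.equivFin ((j : Fin 2) → 𝒳 j) b)).val]? = some true) ↔ a = x (d i) t := by
    intro a
    have e : ∀ b : (j : Fin 2) → 𝒳 j,
        ((uncompressedScheme n hM : Scheme 𝒳 n M).codeword d x)[(finProdFinEquiv
        (t, Fintype.equivFin ((j : Fin 2) → 𝒳 j) b)).val]? = some true
        ↔ (fun j => x j t) = b := fun b => by
      simp only [Scheme.codeword, uncompressedScheme]
      rw [List.getElem?_eq_getElem (by simp only [List.length_ofFn]; exact Fin.isLt _)]
      rw [List.getElem_ofFn]
      simp only [Fin.eta, Equiv.symm_apply_apply, Option.some.injEq, decide_eq_true_eq,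
        EmbeddingLike.apply_eq_iff_eq]
    simp only [e]
    constructor
    · rintro ⟨b, rfl, rfl⟩
      rfl
    · rintro rfl
      exact ⟨_, rfl, rfl⟩
  exact (key _).1 (Classical.epsilon_spec (p := fun a => ∃ b : (j : Fin 2) → 𝒳 j, b (d i) = a ∧
      ((uncompressedScheme n hM : Scheme 𝒳 n M).codeword d x)[(finProdFinEquiv
        (t, Fintype.equivFin ((j : Fin 2) → 𝒳 j) b)).val]? = some true) ⟨_, (key _).2 rfl⟩)

lemma exists_achievable (p : PMF ((j : Fin 2) → 𝒳 j)) (hM : 0 ≤ M) :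
    Achievable p (Fintype.card ((j : Fin 2) → 𝒳 j)) M := by
  classical
  obtain ⟨a, -⟩ := p.support_nonempty
  have : ∀ j, Nonempty (𝒳 j) := fun j => ⟨a j⟩
  -- Block lengths start at 1, so dividing by the length gives exactly the alphabet size as rate.
  refine ⟨fun k => k + 1, fun k => uncompressedScheme (k + 1) hM,
    fun a b h => Nat.add_lt_add_right h 1, ?_, ?_⟩
  · simp [Scheme.errorProb, uncompressedScheme_reconstruction]
  · refine limsup_le_of_le (by isBoundedDefault) (Eventually.of_forall fun k => ?_)
    norm_cast
    have hk : (k : ℝ) + 1 ≠ 0 := by positivity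
    refine ciSup_le fun d => le_of_eq ?_
    simp only [Scheme.codeword, uncompressedScheme, List.length_ofFn, ← Finset.sum_mul,
      sum_libraryProb]
    push_cast
    field_simp

end Region

end

end CodedCaching

theorem theorem1 {𝒳 : Fin 2 → Type*} [∀ j, Fintype (𝒳 j)]
    (p : PMF ((j : Fin 2) → 𝒳 j)) (M : ℝ) (hM : 0 ≤ M) :
    (CodedCaching.regionRates p M).Nonempty ∧ BddBelow (CodedCaching.regionRates p M) ∧
      CodedCaching.lowerBound p M ≤ CodedCaching.optimalRate p M := by
  have hne : (CodedCaching.regionRates p M).Nonempty :=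
    ⟨_, subset_closure (CodedCaching.exists_achievable p hM)⟩
  have hsub := CodedCaching.regionRates_subset p M
  -- Nonemptiness is essential in comparing infima, as the real `sInf` of the empty set is 0.
  exact ⟨hne, ⟨_, fun R hR => (hsub hR).1⟩,
    csInf_le_csInf ⟨_, fun R hR => hR.1⟩ hne hsub⟩
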